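/- Let $(\Omega,\Sigma,\mu)$ be a finite measure space with $\mu(\Omega)>0$, let $X$ be a real Banach space and let $Y\subseteq X$ be a separable closed linear subspace. For $1\le p\le\infty$, $L_p(\Sigma,X)$ denotes the Banach space of ($\mu$-a.e. classes of) strongly measurable functions $\Omega\to X$ that are $p$-Bochner integrable (essentially bounded if $p=\infty$), and $L_p(\Sigma,Y)$ is regarded as a subspace of $L_p(\Sigma,X)$. For a Banach space $E$, a closed subspace $Z\subseteq E$, $n\ge 1$, an ordered $n$-tuple $F=(a_1,\dots,a_n)$ of points of $E$ (repetitions allowed) and a function $f:\mathbb{R}_{\ge0}^n\to\mathbb{R}_{\ge0}$, put $$r_f(x,F)=f(\|x-a_1\|,\dots,\|x-a_n\|)\ (x\in E),\qquad \mathrm{rad}_Z^f(F)=\inf_{z\in Z}r_f(z,F),\qquad \mathrm{Cent}_Z^f(F)=\{z\in Z: r_f(z,F)=\mathrm{rad}_Z^f(F)\}.$$ Let $\mathcal F(E)$ be the collection of all such tuples, over all $n\ge1$. The triplet $(E,Z,\mathcal F(E))$ has **wrcp** (the restricted weighted Chebyshev center property) if $\mathrm{Cent}_Z^f(F)\neq\emptyset$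 for every $n\ge1$, every $n$-tuple $F\in\mathcal F(E)$ and every function of the form $f(\alpha_1,\dots,\alpha_n)=\max_{i}\rho_i\alpha_i$ with weights $\rho_1,\dots,\rho_n\ge0$. For $1\le p<\infty$ let $\mathscr F_p=(f_p^n)_{n\ge1}$, where $f_p^n(\alpha_1,\dots,\alpha_n)=\left(\sum_{i=1}^n\alpha_i^p\right)^{1/p}$; the triplet $(E,Z,\mathcal F(E))$ has **$\mathscr F_p$-rcp** if $\mathrm{Cent}_Z^{f_p^n}(F)\ne\emptyset$ for every $n\ge 1$ and every $n$-tuple $F\in\mathcal F(E)$. Then: (a) $(X,Y,\mathcal F(X))$ has wrcp if and only if $(L_\infty(\Sigma,X),L_\infty(\Sigma,Y),\mathcal F(L_\infty(\Sigma,X)))$ has wrcp. (b) For every $1\le p<\infty$, $(X,Y,\mathcal F(X))$ has $\mathscr F_p$-rcp if and only if $(L_p(\Sigma,X),L_p(\Sigma,Y),\mathcal F(L_p(\Sigma,X)))$ has $\mathscr F_p$-rcp. -/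

import Mathlib

open MeasureTheory
open scoped NNReal ENNReal

noncomputable section

namespace RestrictedCenter

section Centers

variable {X : Type*} [NormedAddCommGroup X] [NormedSpace ℝ X] {n : ℕ}

/-- `r_f(x, F) = f(‖x - a₁‖, …, ‖x - aₙ‖)` for an ordered `n`-tuple `F = (a₁, …, aₙ)` in `X`
(repetitions allowed) and a function `f : ℝ≥0ⁿ → ℝ≥0`. -/
def radiusAt (f : (Fin n → ℝ≥0) → ℝ≥0) (F : Fin n → X) (x : X) : ℝ≥0 :=
  f (fun i => ‖x - F i‖₊)

/-- `rad_Y^f(F) = inf_{y ∈ Y} r_f(y, F)`. The infimum is over a nonempty set, as `0 ∈ Y`. -/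
def rad (Y : Submodule ℝ X) (f : (Fin n → ℝ≥0) → ℝ≥0) (F : Fin n → X) : ℝ≥0 :=
  ⨅ y : Y, radiusAt f F (y : X)

/-- `Cent_Y^f(F)`, the set of restricted `f`-centers of `F` in `Y`: the points of `Y` at which the
infimum `rad_Y^f(F)` is attained. -/
def cent (Y : Submodule ℝ X) (f : (Fin n → ℝ≥0) → ℝ≥0) (F : Fin n → X) : Set X :=
  {y | y ∈ Y ∧ radiusAt f F y = rad Y f F}

/-- The restricted `ℱ`-center property of the triplet `(X, Y, 𝓕(X))`, where `𝓕(X)` is the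
collection of all nonempty finite tuples in `X`, and `ℱ n` is the set of the members of the family
`ℱ` that are functions of `n` variables: every nonempty finite tuple in `X` has a restricted
`f`-center in `Y`, for every `f` in `ℱ` of matching arity. -/
def HasRCP (Y : Submodule ℝ X) (ℱ : ∀ n : ℕ, Set ((Fin n → ℝ≥0) → ℝ≥0)) : Prop :=
  ∀ n : ℕ, 0 < n → ∀ F : Fin n → X, ∀ f ∈ ℱ n, (cent Y f F).Nonempty

/-- The function `α ↦ sup_i ρ_i α_i` attached to the weights `ρ`. -/
def weightedSup (ρ : Fin n → ℝ≥0) (α : Fin n → ℝ≥0) : ℝ≥0 :=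
  Finset.univ.sup (fun i => ρ i * α i)

/-- The restricted weighted Chebyshev center property (wrcp) of the triplet `(X, Y, 𝓕(X))`. The
weights are arbitrary nonnegative reals; on a finite tuple they are automatically bounded. -/
def HasWRCP (Y : Submodule ℝ X) : Prop :=
  ∀ n : ℕ, 0 < n → ∀ F : Fin n → X, ∀ ρ : Fin n → ℝ≥0, (cent Y (weightedSup ρ) F).Nonempty

end Centers

/-- The function `f_p^n(α₁, …, αₙ) = (∑ αᵢ ^ p) ^ (1 / p)`. -/
def lpSum (p : ℝ) (n : ℕ) (α : Fin n → ℝ≥0) : ℝ≥0 :=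
  (∑ i, α i ^ p) ^ (1 / p)

/-- The family `ℱ_p = (f_p^n)_n`, one function for each number `n` of variables. -/
def lpFamily (p : ℝ) (n : ℕ) : Set ((Fin n → ℝ≥0) → ℝ≥0) :=
  {lpSum p n}

/-- `L_p(Σ, Y)` as a subspace of `L_p(Σ, X)`: the image of the space of `Y`-valued functions under
composition with the inclusion `Y → X`. -/
def lpSubspace {Ω X : Type*} [MeasurableSpace Ω] [NormedAddCommGroup X] [NormedSpace ℝ X]
    (Y : Submodule ℝ X) (p : ℝ≥0∞) [Fact (1 ≤ p)] (μ : Measure Ω) :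
    Submodule ℝ (Lp X p μ) :=
  LinearMap.range (Y.subtypeL.compLpL p μ : Lp Y p μ →ₗ[ℝ] Lp X p μ)

end RestrictedCenter

end

/-! The radius in L_p is governed by the pointwise radius: for p < ∞ its p-th power is the integral
of the pointwise p-th power (`radiusAt_lpSum_rpow`), and for p = ∞ it is an essential supremum
(`radiusAt_weightedSup_le_iff`). Hence a measurable choice of pointwise centers is a center in L_p,
with p-integrability coming from comparison with 0 ∈ Y.

Such a choice exists almost everywhere: the relation "y is a center of w" is closed in a product of
Polish spaces, so it is a continuous image of the Baire space, and `exists_measurable_ae_section`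
inverts its projection to the tuples off a null set.

Conversely, a tuple in X is lifted to constant functions. If g is a center of the lift, the
constants from Y are competitors, so g(t) is a center in X for a suitable t: almost every t if p =
∞, and a t where the pointwise p-th power is at most its mean if p < ∞. -/

namespace RestrictedCenter

/-! ### Measurable selection modulo null sets -/

section MeasurableSelection

open Set Filter Topology

/-- The Baire space embeds continuously into the real line. -/
theorem exists_continuous_injective_nat_nat_real :
    ∃ e : (ℕ → ℕ) → ℝ, Continuous e ∧ Function.Injective e := by
  -- The indicator of the graph of `x`, along the pairing bijection. Ratio 1/3 < 1/2 makes the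
  -- Cantor function injective.
  let b : (ℕ → ℕ) → ℕ → Bool := fun x k => decide (x k.unpair.1 = k.unpair.2)
  have hb : Continuous b := by
    refine continuous_pi fun k => ?_
    have h : Continuous fun j : ℕ => decide (j = k.unpair.2) := continuous_of_discreteTopology
    exact h.comp (continuous_apply k.unpair.1)
  have hbi : Function.Injective b := by
    intro x y hxy
    funext i
    have h := congrFun hxy (Nat.pair i (x i))
    simp only [b, Nat.unpair_pair, decide_true] at h
    exact (of_decide_eq_true h.symm).symm
  refine ⟨fun x => Cardinal.cantorFunction (1 / 3) (b x), ?_,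
    (Cardinal.cantorFunction_injective (by norm_num) (by norm_num)).comp hbi⟩
  refine Continuous.comp (g := Cardinal.cantorFunction (1 / 3)) ?_ hb
  unfold Cardinal.cantorFunction
  refine continuous_tsum (u := fun n => (1 / 3 : ℝ) ^ n) (fun n => ?_)
    (summable_geometric_of_lt_one (by norm_num) (by norm_num)) (fun n f => ?_)
  · have h : Continuous fun c : Bool => cond c ((1 / 3 : ℝ) ^ n) 0 := continuous_of_discreteTopology
    exact h.comp (continuous_apply n)
  · cases h : f n
    · rw [Cardinal.cantorFunctionAux_false h, norm_zero]; positivity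
    · rw [Cardinal.cantorFunctionAux_true h, Real.norm_of_nonneg (by positivity)]

/-- An open neighbourhood of a compact box in the Baire space contains a box in which only
finitely many coordinates are constrained. -/
theorem exists_forall_lt_le_subset_of_isOpen {k : ℕ → ℕ} {V : Set (ℕ → ℕ)} (hV : IsOpen V)
    (hk : {x : ℕ → ℕ | ∀ i, x i ≤ k i} ⊆ V) :
    ∃ m, {x : ℕ → ℕ | ∀ i < m, x i ≤ k i} ⊆ V := by
  by_contra! h
  simp only [Set.not_subset] at h
  choose x hx hxV using h
  have hK : IsCompact (Set.pi univ fun i => Iic (k i)) :=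
    isCompact_univ_pi fun i => (finite_Iic (k i)).isCompact
  -- Truncating `x m` by `k` puts it in the compact box and leaves its first `m` coordinates
  -- unchanged, so the limit is also a limit of the untruncated points.
  obtain ⟨a, ha, φ, hφ, hlim⟩ :=
    hK.tendsto_subseq (x := fun m i => min (x m i) (k i)) (fun m i _ => mem_Iic.2 (min_le_right _ _))
  have hlim' : Tendsto (x ∘ φ) atTop (𝓝 a) := by
    rw [tendsto_pi_nhds] at hlim ⊢
    intro i
    refine (hlim i).congr' ?_
    filter_upwards [eventually_gt_atTop i] with m hm
    exact min_eq_left (hx (φ m) i (hm.trans_le (hφ.id_le m)))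
  have haV : a ∈ V := hk fun i => ha i (mem_univ i)
  obtain ⟨m, hm⟩ := (hlim'.eventually (hV.mem_nhds haV)).exists
  exact hxV _ hm

/-- A finite Borel measure on a continuous image of the Baire space is carried, up to `ε`, by the
image of a compact set. -/
theorem exists_isCompact_measure_univ_le_image_add {Z : Type*} [TopologicalSpace Z]
    [MeasurableSpace Z] (ν : Measure Z) [IsFiniteMeasure ν] [ν.OuterRegular]
    {ψ : (ℕ → ℕ) → Z} (hψ : Continuous ψ) (hsurj : Function.Surjective ψ) {ε : ℝ≥0∞}
    (hε : ε ≠ 0) :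
    ∃ K : Set (ℕ → ℕ), IsCompact K ∧ ν univ ≤ ν (ψ '' K) + ε := by
  obtain ⟨δ, hδ, hsum⟩ := ENNReal.exists_pos_sum_of_countable' hε ℕ
  -- Bounding coordinate `m` costs at most `δ m`: continuity from below along increasing unions
  -- needs no measurability of the images.
  have step : ∀ (S : Set (ℕ → ℕ)) (m : ℕ),
      ∃ j, ν (ψ '' S) ≤ ν (ψ '' (S ∩ {x | x m ≤ j})) + δ m := by
    intro S m
    have hmono : Monotone fun j => ψ '' (S ∩ {x | x m ≤ j}) := fun i j hij =>
      image_mono (inter_subset_inter_right _ fun x (hx : x m ≤ i) => hx.trans hij)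
    have hU : ⋃ j, ψ '' (S ∩ {x | x m ≤ j}) = ψ '' S := by
      rw [← image_iUnion, ← inter_iUnion]
      congr 1
      exact inter_eq_left.2 fun x _ => mem_iUnion.2 ⟨x m, le_refl (x m)⟩
    have hm := hmono.measure_iUnion (μ := ν)
    rw [hU] at hm
    by_contra! h
    have h1 : ∀ j, ν (ψ '' (S ∩ {x | x m ≤ j})) + δ m ≤ ν (ψ '' S) := fun j => (h j).le
    have h2 : ν (ψ '' S) + δ m ≤ ν (ψ '' S) := by
      conv_lhs => rw [hm, ENNReal.iSup_add]
      exact iSup_le h1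
    exact (ENNReal.lt_add_right (measure_ne_top ν _) (hδ m).ne').not_ge h2
  choose j hj using step
  let S : ℕ → Set (ℕ → ℕ) := fun m => Nat.rec univ (fun m S => S ∩ {x | x m ≤ j S m}) m
  let k : ℕ → ℕ := fun m => j (S m) m
  have hS : ∀ m, S m = {x | ∀ i < m, x i ≤ k i} := by
    intro m
    induction m with
    | zero => simp [S]
    | succ m ih =>
      have : S (m + 1) = S m ∩ {x | x m ≤ k m} := rfl
      rw [this, ih]
      ext x
      simp only [mem_inter_iff, mem_ofPred_eq, Nat.lt_succ_iff_lt_or_eq]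
      constructor
      · rintro ⟨h1, h2⟩ i (hi | rfl)
        exacts [h1 i hi, h2]
      · exact fun h => ⟨fun i hi => h i (Or.inl hi), h m (Or.inr rfl)⟩
  have hmeas : ∀ m, ν univ ≤ ν (ψ '' S m) + ∑ i ∈ Finset.range m, δ i := by
    intro m
    induction m with
    | zero => simp [S, image_univ, hsurj.range_eq]
    | succ m ih =>
      rw [Finset.sum_range_succ, add_comm _ (δ m), ← add_assoc]
      exact ih.trans (by gcongr; exact hj (S m) m)
  refine ⟨{x | ∀ i, x i ≤ k i}, ?_, ?_⟩
  · convert isCompact_univ_pi fun i => (finite_Iic (k i)).isCompact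
    ext x
    simp only [mem_ofPred_eq, Set.mem_pi, mem_univ, mem_Iic, forall_const]
  -- Outer regularity: an open set around the image of the compact box already contains the image of
  -- some `S m`, whose loss is a partial sum of `δ`.
  · rw [← tsub_le_iff_right, (ψ '' _).measure_eq_iInf_isOpen ν]
    refine le_iInf₂ fun U hU => le_iInf fun hUo => ?_
    obtain ⟨m, hm⟩ := exists_forall_lt_le_subset_of_isOpen (hUo.preimage hψ) (image_subset_iff.1 hU)
    rw [← hS] at hm
    rw [tsub_le_iff_right]
    refine (hmeas m).trans (add_le_add (measure_mono (image_subset_iff.2 hm)) ?_)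
    exact (ENNReal.sum_le_tsum _).trans hsum.le

/-- A continuous map out of the Baire space has a Borel section over the image of each compact
set. -/
theorem exists_measurable_section_of_isCompact {Z : Type*} [TopologicalSpace Z] [T2Space Z]
    [MeasurableSpace Z] [OpensMeasurableSpace Z] {ψ : (ℕ → ℕ) → Z} (hψ : Continuous ψ)
    {K : Set (ℕ → ℕ)} (hK : IsCompact K) :
    ∃ s : Z → ℕ → ℕ, Measurable s ∧ ∀ z ∈ ψ '' K, ψ (s z) = z := by
  classical
  obtain ⟨e, he, hei⟩ := exists_continuous_injective_nat_nat_real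
  -- Select the point of the compact fibre that minimizes `e`.
  have hmin : ∀ z, ∃ x, z ∈ ψ '' K →
      x ∈ K ∧ ψ x = z ∧ ∀ y ∈ K, ψ y = z → e x ≤ e y := by
    intro z
    by_cases hz : z ∈ ψ '' K
    · have hc : IsCompact (K ∩ ψ ⁻¹' {z}) := hK.inter_right (isClosed_singleton.preimage hψ)
      obtain ⟨x, hx, hxm⟩ := hc.exists_isMinOn (by simpa [Set.Nonempty] using hz) he.continuousOn
      exact ⟨x, fun _ => ⟨hx.1, hx.2, fun y hy hyz => hxm ⟨hy, hyz⟩⟩⟩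
    · exact ⟨0, fun h => absurd h hz⟩
  choose s hs using hmin
  have hT : MeasurableSet (ψ '' K) := (hK.image hψ).isClosed.measurableSet
  refine ⟨fun z => if z ∈ ψ '' K then s z else 0, ?_, fun z hz => ?_⟩
  · rw [← (he.measurableEmbedding hei).measurable_comp_iff]
    refine measurable_of_Iic fun c => ?_
    have h1 : MeasurableSet (ψ '' (K ∩ e ⁻¹' Iic c)) :=
      ((hK.inter_right (isClosed_Iic.preimage he)).image hψ).isClosed.measurableSet
    -- By minimality, a sublevel set of the section over `ψ '' K` is the image of a compact set.
    have h2 : (e ∘ fun z => if z ∈ ψ '' K then s z else 0) ⁻¹' Iic c =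
        ψ '' (K ∩ e ⁻¹' Iic c) ∪ ((ψ '' K)ᶜ ∩ {_z | e 0 ≤ c}) := by
      ext z
      by_cases hz : z ∈ ψ '' K
      · simp only [mem_preimage, Function.comp_apply, hz, if_true, mem_Iic, mem_union, mem_inter_iff,
          mem_compl_iff, not_true, false_and, or_false]
        constructor
        · exact fun h => ⟨s z, ⟨(hs z hz).1, h⟩, (hs z hz).2.1⟩
        · rintro ⟨x, ⟨hxK, hxc⟩, hxz⟩
          exact ((hs z hz).2.2 x hxK hxz).trans hxc
      · have hz' : z ∉ ψ '' (K ∩ e ⁻¹' Iic c) := fun h => hz (image_mono inter_subset_left h)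
        simp only [mem_preimage, Function.comp_apply, hz, if_false, mem_Iic, mem_union, mem_inter_iff,
          mem_compl_iff, hz', not_false_eq_true, true_and, false_or, mem_ofPred_eq]
    rw [h2]
    exact h1.union (hT.compl.inter (MeasurableSet.const _))
  · simp only [if_pos hz]
    exact (hs z hz).2.1

/-- A continuous surjection from the Baire space has a Borel section modulo any finite Borel
measure. -/
theorem exists_measurable_ae_section {Z : Type*} [TopologicalSpace Z] [T2Space Z]
    [MeasurableSpace Z] [OpensMeasurableSpace Z] (ν : Measure Z) [IsFiniteMeasure ν]
    [ν.OuterRegular] {ψ : (ℕ → ℕ) → Z} (hψ : Continuous ψ) (hsurj : Function.Surjective ψ) :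
    ∃ s : Z → ℕ → ℕ, Measurable s ∧ ∀ᵐ z ∂ν, ψ (s z) = z := by
  classical
  choose K hK hKν using fun m : ℕ =>
    exists_isCompact_measure_univ_le_image_add ν hψ hsurj (ε := (m : ℝ≥0∞)⁻¹)
      (ENNReal.inv_ne_zero.2 (ENNReal.natCast_ne_top m))
  choose s hs hsK using fun m => exists_measurable_section_of_isCompact hψ (hK m)
  have hT : ∀ m, MeasurableSet (ψ '' K m) := fun m => ((hK m).image hψ).isClosed.measurableSet
  have hTU : MeasurableSet (⋃ m, ψ '' K m) := MeasurableSet.iUnion hT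
  -- The second alternative makes the search total; it concerns only a null set.
  let p : ℕ → Z → Prop := fun m z => z ∈ ψ '' K m ∨ z ∉ ⋃ m, ψ '' K m
  have hp : ∀ z, ∃ m, p m z := by
    intro z
    by_cases hz : z ∈ ⋃ m, ψ '' K m
    · obtain ⟨m, hm⟩ := mem_iUnion.1 hz
      exact ⟨m, Or.inl hm⟩
    · exact ⟨0, Or.inr hz⟩
  refine ⟨fun z => s (Nat.find (hp z)) z,
    Measurable.find (p := p) hs (fun m => (hT m).union hTU.compl) hp, ?_⟩
  have hnull : ν (⋃ m, ψ '' K m)ᶜ = 0 := by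
    have hle : ∀ m : ℕ, ν (⋃ m, ψ '' K m)ᶜ ≤ (m : ℝ≥0∞)⁻¹ := by
      intro m
      rw [measure_compl hTU (measure_ne_top ν _), tsub_le_iff_left]
      exact (hKν m).trans (by gcongr; exact subset_iUnion (fun m => ψ '' K m) m)
    exact le_antisymm (ge_of_tendsto' ENNReal.tendsto_inv_nat_nhds_zero hle) zero_le
  filter_upwards [measure_eq_zero_iff_ae_notMem.1 hnull] with z hz
  rw [notMem_compl_iff] at hz
  rcases Nat.find_spec (hp z) with h | h
  · exact hsK _ z h
  · exact absurd hz h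

/-- Measurable selection: a closed relation between Polish spaces with nonempty sections admits a
Borel selection modulo any finite Borel measure. -/
theorem exists_measurable_ae_selection {Z W : Type*} [TopologicalSpace Z] [PolishSpace Z]
    [MeasurableSpace Z] [BorelSpace Z] [TopologicalSpace W] [PolishSpace W]
    [MeasurableSpace W] [BorelSpace W] [Nonempty Z] (ν : Measure Z) [IsFiniteMeasure ν]
    {C : Set (Z × W)} (hC : IsClosed C) (hne : ∀ z, ∃ w, (z, w) ∈ C) :
    ∃ s : Z → W, Measurable s ∧ ∀ᵐ z ∂ν, (z, s z) ∈ C := by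
  have : PolishSpace C := hC.polishSpace
  have : Nonempty C := by
    obtain ⟨z⟩ := ‹Nonempty Z›
    obtain ⟨w, hw⟩ := hne z
    exact ⟨⟨(z, w), hw⟩⟩
  obtain ⟨φ, hφ, hφs⟩ := PolishSpace.exists_nat_nat_continuous_surjective C
  -- A compatible metric gives outer regularity of `ν`.
  let := TopologicalSpace.upgradeIsCompletelyMetrizable Z
  have hfst : Function.Surjective fun c : C => (c : Z × W).1 := fun z =>
    let ⟨w, hw⟩ := hne z
    ⟨⟨(z, w), hw⟩, rfl⟩
  obtain ⟨s, hs, hsν⟩ := exists_measurable_ae_section ν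
    (ψ := fun x => (φ x : Z × W).1) (continuous_fst.comp (continuous_subtype_val.comp hφ))
    (hfst.comp hφs)
  refine ⟨fun z => (φ (s z) : Z × W).2,
    (continuous_snd.comp (continuous_subtype_val.comp hφ)).measurable.comp hs, ?_⟩
  filter_upwards [hsν] with z hz
  have h := (φ (s z)).2
  rwa [← Prod.mk.eta (p := (φ (s z) : Z × W)), hz] at h

end MeasurableSelection

/-! ### Centers as minimizers; the radius functions -/

section Minimizers

variable {X : Type*} [NormedAddCommGroup X] {n : ℕ}

theorem mem_cent_iff [NormedSpace ℝ X] {Y : Submodule ℝ X} {f : (Fin n → ℝ≥0) → ℝ≥0}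
    {F : Fin n → X} {y : X} :
    y ∈ cent Y f F ↔ y ∈ Y ∧ ∀ z ∈ Y, radiusAt f F y ≤ radiusAt f F z := by
  refine and_congr_right fun hy => ⟨fun h z hz => ?_, fun h => le_antisymm ?_ ?_⟩
  · rw [h]
    exact ciInf_le (OrderBot.bddBelow _) (⟨z, hz⟩ : Y)
  · exact le_ciInf fun z => h z z.2
  · exact ciInf_le (OrderBot.bddBelow _) (⟨y, hy⟩ : Y)

theorem continuous_radiusAt {f : (Fin n → ℝ≥0) → ℝ≥0} (hf : Continuous f)
    {T : Type*} [TopologicalSpace T] {F : T → Fin n → X} {x : T → X} (hF : Continuous F)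
    (hx : Continuous x) : Continuous fun t => radiusAt f (F t) (x t) :=
  hf.comp (continuous_pi fun i => (hx.sub ((continuous_apply i).comp hF)).nnnorm)

theorem stronglyMeasurable_radiusAt {f : (Fin n → ℝ≥0) → ℝ≥0}
    (hf : Continuous f) {Ω : Type*} [MeasurableSpace Ω] {F : Fin n → Ω → X} {x : Ω → X}
    (hF : ∀ i, StronglyMeasurable (F i)) (hx : StronglyMeasurable x) :
    StronglyMeasurable fun t => radiusAt f (fun i => F i t) (x t) :=
  hf.comp_stronglyMeasurable
    (measurable_pi_lambda _ fun i => (hx.sub (hF i)).nnnorm.measurable).stronglyMeasurable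

theorem continuous_weightedSup (ρ : Fin n → ℝ≥0) : Continuous (weightedSup ρ) :=
  Continuous.finset_sup_apply fun i _ => continuous_const.mul (continuous_apply i)

theorem continuous_lpSum {p : ℝ} (hp : 0 < p) : Continuous (lpSum p n) :=
  (NNReal.continuous_rpow_const (by positivity)).comp
    (continuous_finsetSum _ fun i _ =>
      (NNReal.continuous_rpow_const hp.le).comp (continuous_apply i))

theorem lpSum_rpow {p : ℝ} (hp : 0 < p) (α : Fin n → ℝ≥0) : lpSum p n α ^ p = ∑ i, α i ^ p := by
  rw [lpSum, ← NNReal.rpow_mul, one_div_mul_cancel hp.ne', NNReal.rpow_one]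

theorem le_lpSum {p : ℝ} (hp : 0 < p) (α : Fin n → ℝ≥0) (j : Fin n) : α j ≤ lpSum p n α := by
  rw [← NNReal.rpow_le_rpow_iff hp, lpSum_rpow hp]
  exact Finset.single_le_sum (f := fun i => α i ^ p) (fun _ _ => zero_le) (Finset.mem_univ j)

theorem weightedSup_le_iff {ρ α : Fin n → ℝ≥0} {r : ℝ≥0} :
    weightedSup ρ α ≤ r ↔ ∀ i, ρ i * α i ≤ r := by
  simp [weightedSup]

theorem coe_radiusAt_lpSum_rpow {p : ℝ} (hp : 0 < p) (F : Fin n → X) (x : X) :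
    (radiusAt (lpSum p n) F x : ℝ≥0∞) ^ p = ∑ i, ‖x - F i‖ₑ ^ p := by
  rw [← ENNReal.coe_rpow_of_nonneg _ hp.le, radiusAt, lpSum_rpow hp, ENNReal.ofNNReal_finsetSum]
  simp only [enorm, ENNReal.coe_rpow_of_nonneg _ hp.le]

end Minimizers

/-! ### Measurable selection of centers -/

section Selection

theorem polishSpace_of_isClosed_of_isSeparable {X : Type*} [NormedAddCommGroup X]
    [CompleteSpace X] {s : Set X} (hs : IsClosed s) (hs' : TopologicalSpace.IsSeparable s) :
    PolishSpace s := by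
  have := hs.completeSpace_coe
  have := hs'.separableSpace
  have := UniformSpace.secondCountable_of_separable s
  infer_instance

variable {Ω X : Type*} [MeasurableSpace Ω] (μ : Measure Ω) [IsFiniteMeasure μ]
  [NormedAddCommGroup X] [NormedSpace ℝ X] [CompleteSpace X]

/-- Centers of a strongly measurable family of tuples can be selected measurably, almost
everywhere. -/
theorem exists_stronglyMeasurable_ae_mem_cent {Y : Submodule ℝ X} (hYc : IsClosed (Y : Set X))
    (hYs : TopologicalSpace.IsSeparable (Y : Set X)) {n : ℕ} {f : (Fin n → ℝ≥0) → ℝ≥0}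
    (hf : Continuous f) (hne : ∀ G : Fin n → X, (cent Y f G).Nonempty) {F : Fin n → Ω → X}
    (hF : ∀ i, StronglyMeasurable (F i)) :
    ∃ g : Ω → Y, StronglyMeasurable g ∧ ∀ᵐ t ∂μ, (g t : X) ∈ cent Y f fun i => F i t := by
  rcases isEmpty_or_nonempty Ω with hΩ | hΩ
  · exact ⟨fun _ => 0, stronglyMeasurable_const, Filter.Eventually.of_forall fun t => hΩ.elim t⟩
  borelize X
  -- X need not be separable, but the values of the tuple lie in a closed separable set.
  let W : Set X := closure (⋃ i, Set.range (F i))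
  have hWP : PolishSpace W := polishSpace_of_isClosed_of_isSeparable isClosed_closure
    (TopologicalSpace.IsSeparable.iUnion fun i => (hF i).isSeparable_range).closure
  have hYP : PolishSpace Y := polishSpace_of_isClosed_of_isSeparable hYc hYs
  have hFW : ∀ i t, F i t ∈ W := fun i t =>
    subset_closure (Set.mem_iUnion.2 ⟨i, Set.mem_range_self t⟩)
  let Φ : Ω → Fin n → W := fun t i => ⟨F i t, hFW i t⟩
  have hΦ : Measurable Φ := measurable_pi_lambda _ fun i => (hF i).measurable.subtype_mk
  have : Nonempty (Fin n → W) := hΩ.map Φ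
  let C : Set ((Fin n → W) × Y) := {q | ∀ z : Y,
    radiusAt f (fun i => (q.1 i : X)) (q.2 : X) ≤ radiusAt f (fun i => (q.1 i : X)) (z : X)}
  have hC : IsClosed C := by
    have hq : Continuous fun (q : (Fin n → W) × Y) (i : Fin n) => (q.1 i : X) := by fun_prop
    have : C = ⋂ z : Y, {q | radiusAt f (fun i => (q.1 i : X)) (q.2 : X) ≤
        radiusAt f (fun i => (q.1 i : X)) (z : X)} := by
      ext q
      simp [C]
    rw [this]
    exact isClosed_iInter fun z => isClosed_le
      (continuous_radiusAt hf hq (by fun_prop)) (continuous_radiusAt hf hq continuous_const)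
  obtain ⟨s, hs, hsC⟩ := exists_measurable_ae_selection (μ.map Φ) hC fun w => by
    obtain ⟨y, hy⟩ := hne fun i => (w i : X)
    rw [mem_cent_iff] at hy
    exact ⟨⟨y, hy.1⟩, fun z => hy.2 z z.2⟩
  refine ⟨fun t => s (Φ t), (hs.comp hΦ).stronglyMeasurable, ?_⟩
  filter_upwards [ae_of_ae_map hΦ.aemeasurable hsC] with t ht
  exact mem_cent_iff.2 ⟨(s (Φ t)).2, fun z hz => ht ⟨z, hz⟩⟩

end Selection

/-! ### The radius in L_p through the pointwise radius -/

section PointwiseRadius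

variable {Ω X : Type*} [MeasurableSpace Ω] {μ : Measure Ω} [NormedAddCommGroup X] {p : ℝ≥0∞}
  {n : ℕ}

theorem radiusAt_const_ae [IsFiniteMeasure μ] (f : (Fin n → ℝ≥0) → ℝ≥0) (F : Fin n → X)
    (g : Ω → X) :
    ∀ᵐ t ∂μ, radiusAt f (fun i => (Lp.const p μ (F i) : Lp X p μ) t) (g t) =
      radiusAt f F (g t) := by
  filter_upwards [ae_all_iff.2 fun i => Lp.coeFn_const p μ (F i)] with t ht
  simp only [ht, Function.const_apply]

/-- The `p`-th power of the radius in `L_p` is the integral of the pointwise one. -/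
theorem radiusAt_lpSum_rpow [Fact (1 ≤ p)] (hp : p ≠ ∞) (F : Fin n → Lp X p μ)
    (g : Lp X p μ) :
    (radiusAt (lpSum p.toReal n) F g : ℝ≥0∞) ^ p.toReal =
      ∫⁻ t, (radiusAt (lpSum p.toReal n) (fun i => F i t) (g t) : ℝ≥0∞) ^ p.toReal ∂μ := by
  have h1 : 1 ≤ p := Fact.out
  have hp0 : p ≠ 0 := (zero_lt_one.trans_le h1).ne'
  have hpos : 0 < p.toReal := ENNReal.toReal_pos hp0 hp
  simp only [coe_radiusAt_lpSum_rpow hpos]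
  rw [lintegral_finsetSum (f := fun i t => ‖g t - F i t‖ₑ ^ p.toReal) _ fun i _ =>
    (((Lp.stronglyMeasurable g).sub (Lp.stronglyMeasurable (F i))).enorm.pow_const _)]
  refine Finset.sum_congr rfl fun i _ => ?_
  rw [Lp.enorm_def, eLpNorm_congr_ae (Lp.coeFn_sub g (F i)),
    eLpNorm_eq_lintegral_rpow_enorm_toReal hp0 hp, ← ENNReal.rpow_mul,
    one_div_mul_cancel hpos.ne', ENNReal.rpow_one]
  rfl

/-- The weighted radius in `L_∞` is the essential supremum of the pointwise one. -/
theorem radiusAt_weightedSup_le_iff (ρ : Fin n → ℝ≥0) (F : Fin n → Lp X ∞ μ) (g : Lp X ∞ μ)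
    (r : ℝ≥0) :
    radiusAt (weightedSup ρ) F g ≤ r ↔
      ∀ᵐ t ∂μ, radiusAt (weightedSup ρ) (fun i => F i t) (g t) ≤ r := by
  simp only [radiusAt, weightedSup_le_iff, ae_all_iff]
  refine forall_congr' fun i => ?_
  -- A zero weight imposes no condition; a positive one can be divided out.
  rcases eq_or_ne (ρ i) 0 with h0 | h0
  · simp [h0]
  · have hpos : 0 < ρ i := pos_iff_ne_zero.2 h0
    simp only [mul_comm (ρ i), ← le_div_iff₀ hpos, ← ENNReal.coe_le_coe]
    change ‖g - F i‖ₑ ≤ _ ↔ ∀ᵐ t ∂μ, ‖g t - F i t‖ₑ ≤ _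
    rw [Lp.enorm_def, eLpNorm_exponent_top]
    have hsub : ∀ᵐ t ∂μ, (g - F i : Lp X ∞ μ) t = g t - F i t := Lp.coeFn_sub g (F i)
    constructor
    · intro h
      filter_upwards [ae_le_eLpNormEssSup (f := (g - F i : Lp X ∞ μ)) (μ := μ), hsub] with t h1 h2
      rw [← h2]
      exact h1.trans h
    · intro h
      refine eLpNormEssSup_le_of_ae_enorm_bound ?_
      filter_upwards [h, hsub] with t h1 h2
      rwa [h2]

end PointwiseRadius

/-! ### Transfer of centers between X and L_p -/

section BochnerSpaces

variable {Ω X : Type*} [MeasurableSpace Ω] {μ : Measure Ω}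
  [NormedAddCommGroup X] [NormedSpace ℝ X] {Y : Submodule ℝ X} {p : ℝ≥0∞} [Fact (1 ≤ p)] {n : ℕ}

theorem ae_mem_of_mem_lpSubspace {g : Lp X p μ} (hg : g ∈ lpSubspace Y p μ) :
    ∀ᵐ t ∂μ, g t ∈ Y := by
  obtain ⟨h, rfl⟩ := hg
  filter_upwards [Y.subtypeL.coeFn_compLpL h] with t ht
  have h2 : ((Y.subtypeL.compLpL p μ) h : Lp X p μ) t ∈ Y := by
    rw [ht]
    exact (h t).2
  exact h2

theorem toLp_mem_lpSubspace {g : Ω → Y} (hg : StronglyMeasurable g)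
    (hgp : MemLp (fun t => (g t : X)) p μ) : hgp.toLp _ ∈ lpSubspace Y p μ := by
  have hg' : MemLp g p μ := MemLp.of_le hgp hg.aestronglyMeasurable
    (Filter.Eventually.of_forall fun t => le_rfl)
  refine ⟨hg'.toLp g, ?_⟩
  refine Lp.ext ?_
  refine (Y.subtypeL.coeFn_compLpL _).trans ?_
  filter_upwards [hg'.coeFn_toLp, hgp.coeFn_toLp] with t h1 h2
  rw [h1, h2]
  rfl

theorem const_mem_lpSubspace [IsFiniteMeasure μ] {y : X} (hy : y ∈ Y) :
    Lp.const p μ y ∈ lpSubspace Y p μ :=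
  toLp_mem_lpSubspace (g := fun _ => ⟨y, hy⟩) stronglyMeasurable_const (memLp_const y)

/-- Restricted centers in `X` lift to restricted centers in `L_p`, provided the radius in `L_p` is
monotone in the pointwise radius and the pointwise radius is `p`-integrable and controls the
distance to one of the points. -/
theorem cent_lpSubspace_nonempty [IsFiniteMeasure μ] [CompleteSpace X]
    (hYc : IsClosed (Y : Set X)) (hYs : TopologicalSpace.IsSeparable (Y : Set X))
    {f : (Fin n → ℝ≥0) → ℝ≥0} (hf : Continuous f) (j : Fin n) (c : ℝ≥0)
    (hfj : ∀ α, α j ≤ c * f α) (F : Fin n → Lp X p μ)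
    (hmono : ∀ g h : Lp X p μ, (∀ᵐ t ∂μ, radiusAt f (fun i => F i t) (g t) ≤
      radiusAt f (fun i => F i t) (h t)) → radiusAt f F g ≤ radiusAt f F h)
    (hint : MemLp (fun t => (radiusAt f (fun i => F i t) 0 : ℝ)) p μ)
    (hne : ∀ G : Fin n → X, (cent Y f G).Nonempty) :
    (cent (lpSubspace Y p μ) f F).Nonempty := by
  obtain ⟨g, hg, hgc⟩ := exists_stronglyMeasurable_ae_mem_cent μ hYc hYs hf hne
    fun i => Lp.stronglyMeasurable (F i)
  have hgp : MemLp (fun t => (g t : X)) p μ := by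
    refine MemLp.mono' ((Lp.memLp (F j)).norm.add (hint.const_mul (c : ℝ)))
      (continuous_subtype_val.comp_stronglyMeasurable hg).aestronglyMeasurable ?_
    filter_upwards [hgc] with t ht
    -- The center `g t` does at least as well as 0 ∈ Y.
    have h1 : ‖(g t : X) - F j t‖₊ ≤ c * radiusAt f (fun i => F i t) 0 :=
      (hfj _).trans (mul_le_mul_right ((mem_cent_iff.1 ht).2 0 Y.zero_mem) c)
    have h2 : ‖(g t : X) - F j t‖ ≤ c * radiusAt f (fun i => F i t) 0 := by exact_mod_cast h1
    calc ‖(g t : X)‖ = ‖F j t + ((g t : X) - F j t)‖ := by rw [add_sub_cancel]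
      _ ≤ ‖F j t‖ + ‖(g t : X) - F j t‖ := norm_add_le _ _
      _ ≤ _ := by simpa using h2
  refine ⟨hgp.toLp _, mem_cent_iff.2 ⟨toLp_mem_lpSubspace hg hgp, fun h hh => hmono _ _ ?_⟩⟩
  filter_upwards [hgc, hgp.coeFn_toLp, ae_mem_of_mem_lpSubspace hh] with t h1 h2 h3
  rw [h2]
  exact (mem_cent_iff.1 h1).2 _ h3

theorem HasRCP.lpSubspace [IsFiniteMeasure μ] [CompleteSpace X] (hYc : IsClosed (Y : Set X))
    (hYs : TopologicalSpace.IsSeparable (Y : Set X)) (hp : p ≠ ∞)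
    (h : HasRCP Y (lpFamily p.toReal)) :
    HasRCP (lpSubspace Y p μ) (lpFamily p.toReal) := by
  rintro n hn F f rfl
  have h1 : 1 ≤ p := Fact.out
  have hp0 : p ≠ 0 := (zero_lt_one.trans_le h1).ne'
  have hpos : 0 < p.toReal := ENNReal.toReal_pos hp0 hp
  refine cent_lpSubspace_nonempty hYc hYs (continuous_lpSum hpos) ⟨0, hn⟩ 1
    (fun α => by rw [one_mul]; exact le_lpSum hpos α _) F (fun g h hgh => ?_) ?_
    fun G => h n hn G _ rfl
  · rw [← ENNReal.coe_le_coe, ← ENNReal.rpow_le_rpow_iff hpos, radiusAt_lpSum_rpow hp,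
      radiusAt_lpSum_rpow hp]
    refine lintegral_mono_ae ?_
    filter_upwards [hgh] with t ht
    gcongr
  · refine ⟨(NNReal.continuous_coe.comp_stronglyMeasurable (stronglyMeasurable_radiusAt
      (continuous_lpSum hpos) (fun i => Lp.stronglyMeasurable (F i))
      stronglyMeasurable_const)).aestronglyMeasurable, ?_⟩
    rw [eLpNorm_lt_top_iff_lintegral_rpow_enorm_lt_top hp0 hp]
    have h2 := radiusAt_lpSum_rpow hp F 0
    have h3 : ∫⁻ t, ‖(radiusAt (lpSum p.toReal n) (fun i => F i t) 0 : ℝ)‖ₑ ^ p.toReal ∂μ =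
        ∫⁻ t, (radiusAt (lpSum p.toReal n) (fun i => F i t) ((0 : Lp X p μ) t) : ℝ≥0∞) ^ p.toReal
          ∂μ := by
      refine lintegral_congr_ae ?_
      filter_upwards [Lp.coeFn_zero X p μ] with t ht
      rw [ht, Pi.zero_apply, NNReal.enorm_eq]
    rw [h3, ← h2]
    exact ENNReal.rpow_lt_top_of_nonneg hpos.le ENNReal.coe_ne_top

theorem HasRCP.of_lpSubspace [IsFiniteMeasure μ] (hμ : μ ≠ 0) (hp : p ≠ ∞)
    (h : HasRCP (RestrictedCenter.lpSubspace Y p μ) (lpFamily p.toReal)) :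
    HasRCP Y (lpFamily p.toReal) := by
  rintro n hn F f rfl
  have h1 : 1 ≤ p := Fact.out
  have hp0 : p ≠ 0 := (zero_lt_one.trans_le h1).ne'
  have hpos : 0 < p.toReal := ENNReal.toReal_pos hp0 hp
  obtain ⟨g, hg⟩ := h n hn (fun i => Lp.const p μ (F i)) _ rfl
  rw [mem_cent_iff] at hg
  have hmeas : Measurable fun t => (radiusAt (lpSum p.toReal n) F (g t) : ℝ≥0∞) ^ p.toReal :=
    (stronglyMeasurable_radiusAt (continuous_lpSum hpos) (fun _ => stronglyMeasurable_const)
      (Lp.stronglyMeasurable g)).measurable.coe_nnreal_ennreal.pow_const _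
  -- Off the null set where `g` leaves Y, some value is at most the mean.
  obtain ⟨t, htN, ht⟩ := exists_notMem_null_le_laverage hμ hmeas.aemeasurable
    (ae_iff.1 (ae_mem_of_mem_lpSubspace hg.1))
  refine ⟨g t, mem_cent_iff.2 ⟨not_not.1 htN, fun y hy => ?_⟩⟩
  have hle := hg.2 _ (const_mem_lpSubspace (p := p) (μ := μ) hy)
  rw [← ENNReal.coe_le_coe, ← ENNReal.rpow_le_rpow_iff hpos, radiusAt_lpSum_rpow hp,
    radiusAt_lpSum_rpow hp] at hle
  rw [← ENNReal.coe_le_coe, ← ENNReal.rpow_le_rpow_iff hpos]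
  refine ht.trans ?_
  have hleft : ∫⁻ t, (radiusAt (lpSum p.toReal n) F (g t) : ℝ≥0∞) ^ p.toReal ∂μ ≤
      ∫⁻ _, (radiusAt (lpSum p.toReal n) F y : ℝ≥0∞) ^ p.toReal ∂μ := by
    refine le_of_eq_of_le (lintegral_congr_ae ?_) (hle.trans_eq (lintegral_congr_ae ?_))
    · filter_upwards [radiusAt_const_ae (lpSum p.toReal n) F g] with t ht
      rw [ht]
    · filter_upwards [radiusAt_const_ae (lpSum p.toReal n) F (Lp.const p μ y),
        Lp.coeFn_const p μ y] with t ht hy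
      rw [ht, hy, Function.const_apply]
  have : NeZero μ := ⟨hμ⟩
  calc ⨍⁻ t, (radiusAt (lpSum p.toReal n) F (g t) : ℝ≥0∞) ^ p.toReal ∂μ
      ≤ ⨍⁻ _, (radiusAt (lpSum p.toReal n) F y : ℝ≥0∞) ^ p.toReal ∂μ := by
        rw [laverage_eq, laverage_eq]
        gcongr
    _ = _ := laverage_const μ _

theorem HasWRCP.lpSubspace [IsFiniteMeasure μ] [CompleteSpace X] (hYc : IsClosed (Y : Set X))
    (hYs : TopologicalSpace.IsSeparable (Y : Set X)) (h : HasWRCP Y) :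
    HasWRCP (lpSubspace Y ∞ μ) := by
  intro n hn F ρ
  by_cases hρ : ∃ j, ρ j ≠ 0
  · obtain ⟨j, hj⟩ := hρ
    refine cent_lpSubspace_nonempty hYc hYs (continuous_weightedSup ρ) j (ρ j)⁻¹ (fun α => ?_) F
      (fun g h hgh => ?_) ?_ fun G => h n hn G ρ
    · rw [← div_eq_inv_mul, le_div_iff₀ (pos_iff_ne_zero.2 hj), mul_comm]
      exact weightedSup_le_iff.1 le_rfl j
    · rw [radiusAt_weightedSup_le_iff]
      filter_upwards [hgh, (radiusAt_weightedSup_le_iff ρ F h _).1 le_rfl] with t h1 h2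
      exact h1.trans h2
    · refine memLp_top_of_bound (NNReal.continuous_coe.comp_stronglyMeasurable
        (stronglyMeasurable_radiusAt (continuous_weightedSup ρ)
        (fun i => Lp.stronglyMeasurable (F i)) stronglyMeasurable_const)).aestronglyMeasurable
        (radiusAt (weightedSup ρ) F 0) ?_
      filter_upwards [(radiusAt_weightedSup_le_iff ρ F 0 _).1 le_rfl, Lp.coeFn_zero X ∞ μ]
        with t h1 h2
      rw [h2, Pi.zero_apply] at h1
      rw [Real.norm_of_nonneg (NNReal.coe_nonneg _)]
      exact_mod_cast h1
  -- With all weights zero the radius vanishes identically, so 0 is a center.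
  · push Not at hρ
    refine ⟨0, mem_cent_iff.2 ⟨Submodule.zero_mem _, fun z _ => ?_⟩⟩
    exact weightedSup_le_iff.2 fun i => by simp [hρ i]

theorem HasWRCP.of_lpSubspace [IsFiniteMeasure μ] (hμ : μ ≠ 0)
    (h : HasWRCP (RestrictedCenter.lpSubspace Y ∞ μ)) : HasWRCP Y := by
  intro n hn F ρ
  obtain ⟨g, hg⟩ := h n hn (fun i => Lp.const ∞ μ (F i)) ρ
  rw [mem_cent_iff] at hg
  have : NeZero μ := ⟨hμ⟩
  obtain ⟨t, h1, h2, h3⟩ := ((ae_mem_of_mem_lpSubspace hg.1).and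
    (((radiusAt_weightedSup_le_iff ρ _ g _).1 le_rfl).and
      (radiusAt_const_ae (weightedSup ρ) F g))).exists
  refine ⟨g t, mem_cent_iff.2 ⟨h1, fun y hy => ?_⟩⟩
  rw [← h3]
  refine h2.trans ((hg.2 _ (const_mem_lpSubspace (p := ∞) (μ := μ) hy)).trans ?_)
  rw [radiusAt_weightedSup_le_iff]
  filter_upwards [radiusAt_const_ae (weightedSup ρ) F (Lp.const ∞ μ y), Lp.coeFn_const ∞ μ y]
    with t ht hy
  rw [ht, hy, Function.const_apply]

end BochnerSpaces

end RestrictedCenter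

theorem theorem3p2 {Ω X : Type*} [MeasurableSpace Ω] (μ : MeasureTheory.Measure Ω)
    [MeasureTheory.IsFiniteMeasure μ] (hμ : μ ≠ 0)
    [NormedAddCommGroup X] [NormedSpace ℝ X] [CompleteSpace X]
    (Y : Submodule ℝ X) (hYc : IsClosed (Y : Set X))
    (hYs : TopologicalSpace.IsSeparable (Y : Set X)) :
    (RestrictedCenter.HasWRCP Y ↔
      RestrictedCenter.HasWRCP (RestrictedCenter.lpSubspace Y ∞ μ)) ∧
    (∀ (p : ℝ≥0∞) [Fact (1 ≤ p)], p ≠ ∞ →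
      (RestrictedCenter.HasRCP Y (RestrictedCenter.lpFamily p.toReal) ↔
        RestrictedCenter.HasRCP (RestrictedCenter.lpSubspace Y p μ)
          (RestrictedCenter.lpFamily p.toReal))) :=
  ⟨⟨fun h => h.lpSubspace hYc hYs, fun h => h.of_lpSubspace hμ⟩,
    fun _ _ hp => ⟨fun h => h.lpSubspace hYc hYs hp, fun h => h.of_lpSubspace hμ hp⟩⟩
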